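/- All graphs are finite and simple. Write $\alpha(G)$ for the independence number of $G$. For $S\subseteq V(G)$, let $G-S$ be the subgraph of $G$ induced on $V(G)\setminus S$. For integers $k>\ell\ge 0$, a graph $G$ is called $(k,\ell)$-stable if $\alpha(G-S)\ge\alpha(G)-\ell$ for every $S\subseteq V(G)$ with $|S|=k$. Theorem. For every real constant $q>0$ and every integer $k\ge 3$, there is a constant $C_{q,k}$ such that every $(k,0)$-stable graph $G$ with $\alpha(G)\ge |V(G)|/2-q$ has at most $C_{q,k}$ vertices. In particular, the following question of Dong and Luo has a negative answer: is there a constant $c>0$ and a sequence of $(3,0)$-stable graphs $G$ with $|V(G)|\to\infty$ and $\alpha(G)\ge |V(G)|/2-c$ for every member of the sequence? -/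

import Mathlib

universe u

/-- A graph `G` is `(k, l)`-stable if `α(G - S) ≥ α(G) - l` for every set `S` of exactly `k`
vertices. Here `α` is the independence number, and `G - S` is the subgraph induced on the
complement of `S`; the inequality is written without subtraction. -/
def SimpleGraph.IsStable {V : Type*} (G : SimpleGraph V) (k l : ℕ) : Prop :=
  ∀ S : Finset V, S.card = k → G.indepNum ≤ (G.induce ((S : Set V)ᶜ)).indepNum + l

/-! Stability lets every set of at most three vertices be avoided by a maximum independent set, and
deleting edges while α stays fixed makes every edge critical. Fix a maximum independent set A, and
let |V| ≤ 2α + D. On subsets Y of the complement, the surplus |N_A(Y)| - |Y| is submodular,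
nonnegative if Y is independent (else a swap enlarges A), and always at least -D (Hall's condition).

An edge outside A yields a critical set of negative surplus. Uncrossing many of these would go below
-D, so by Ramsey boundedly many vertices are non-isolated in the complement
(`exists_card_nbrsIn_compl_lt`).

Any other b outside A has three neighbours a in A. Criticality of ba gives a tight set (surplus 0)
through b that stays tight without b, losing only a from its neighbourhood. After pigeonholing, the
tight sets for each of the three choices of a lie in a common independent set, where they form a
lattice, so least ones exist. By Ramsey, each of the three families contains a chain or an
antichain. Exchanging an antichain into A makes too many vertices non-isolated outside the new set
(`exists_le_card_nbrsIn_compl`). So two families form chains in the same direction; where the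
minimal surplus above their intersections stalls, b would add two private neighbours at no gain
(`not_chain`). Hence the complement of A is bounded, and |A| is at most its size. -/

/-! ### Ramsey's theorem for ordered pairs -/

/-- Ramsey's theorem for ordered pairs, asymmetric form: a finite set that is large enough contains,
for every colouring of pairs, a homogeneous list of prescribed length for one of the colours. -/
theorem exists_ramsey_list {κ : Type} [Fintype κ] [DecidableEq κ] (n : ℕ) :
    ∀ N : κ → ℕ, ∑ c, N c = n → ∃ M : ℕ, ∀ {α : Type u} (S : Finset α) (f : α → α → κ),
      M ≤ S.card → ∃ (c : κ) (l : List α), l.length = N c ∧ l.Nodup ∧ (∀ x ∈ l, x ∈ S) ∧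
        l.Pairwise (fun x y => f x y = c) := by
  classical
  induction n with
  | zero =>
    intro N hN
    -- One point of `S` is needed to exhibit a colour, since `κ` may be empty.
    refine ⟨1, fun S f hS => ?_⟩
    obtain ⟨x, hx⟩ : S.Nonempty := Finset.card_pos.mp hS
    have : N (f x x) = 0 := by
      have := Finset.sum_eq_zero_iff.mp hN
      exact this _ (Finset.mem_univ _)
    exact ⟨f x x, [], by simp [this], by simp, by simp, by simp⟩
  | succ n ih =>
    intro N hN
    by_cases hz : ∃ c, N c = 0
    · obtain ⟨c, hc⟩ := hz
      exact ⟨0, fun S f _ => ⟨c, [], by simp [hc], by simp, by simp, by simp⟩⟩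
    push Not at hz
    have hdec : ∀ c, ∑ d, (Function.update N c (N c - 1)) d = n := by
      intro c
      have h1 := Finset.sum_update_of_mem (Finset.mem_univ c) N (N c - 1)
      have h2 := Finset.add_sum_erase Finset.univ N (Finset.mem_univ c)
      have h3 := hz c
      rw [Finset.sdiff_singleton_eq_erase] at h1
      omega
    choose M hM using fun c => ih _ (hdec c)
    refine ⟨1 + ∑ c, M c + 1, fun S f hS => ?_⟩
    obtain ⟨x, hx⟩ : S.Nonempty := Finset.card_pos.mp (by omega)
    obtain ⟨c, hc⟩ : ∃ c, M c ≤ ((S.erase x).filter (fun y => f x y = c)).card := by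
      by_contra! hcon
      have h1 : (S.erase x).card = ∑ c, ((S.erase x).filter (fun y => f x y = c)).card :=
        Finset.card_eq_sum_card_fiberwise (fun _ _ => Finset.mem_coe.mpr (Finset.mem_univ _))
      have h2 := Finset.sum_le_sum (s := Finset.univ) (fun c _ => (hcon c).le)
      rw [Finset.card_erase_of_mem hx] at h1
      omega
    obtain ⟨d, l, hl, hnd, hmem, hpw⟩ := hM c _ f hc
    have hmem' : ∀ y ∈ l, y ≠ x ∧ y ∈ S ∧ f x y = c := by
      intro y hy
      simpa [and_assoc] using hmem y hy
    by_cases hdc : d = c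
    · subst hdc
      refine ⟨d, x :: l, ?_, ?_, ?_, ?_⟩
      · have := hz d
        simp only [Function.update_self] at hl
        simp only [List.length_cons]
        omega
      · exact List.nodup_cons.mpr ⟨fun h => (hmem' x h).1 rfl, hnd⟩
      · intro y hy
        rcases List.mem_cons.mp hy with rfl | hy
        · exact hx
        · exact (hmem' y hy).2.1
      · exact List.pairwise_cons.mpr ⟨fun y hy => (hmem' y hy).2.2, hpw⟩
    · refine ⟨d, l, by rw [hl, Function.update_of_ne hdc], hnd, fun y hy => (hmem' y hy).2.1, hpw⟩

/-- Ramsey's theorem for ordered pairs: a homogeneous sequence of length `N`. -/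
theorem exists_ramsey (κ : Type) [Fintype κ] (N : ℕ) :
    ∃ M : ℕ, ∀ {α : Type u} (S : Finset α) (f : α → α → κ), M ≤ S.card →
      ∃ (c : κ) (s : Fin N → α), Function.Injective s ∧ (∀ i, s i ∈ S) ∧
        ∀ i j, i < j → f (s i) (s j) = c := by
  classical
  obtain ⟨M, hM⟩ := exists_ramsey_list.{u} (κ := κ) _ (fun _ => N) rfl
  refine ⟨M, fun S f hS => ?_⟩
  obtain ⟨c, l, rfl, hnd, hmem, hpw⟩ := hM S f hS
  exact ⟨c, l.get, hnd.injective_get, fun i => hmem _ (l.get_mem i),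
    fun i j hij => List.pairwise_iff_get.mp hpw i j hij⟩

/-! ### Surplus and exchange -/

namespace SimpleGraph

section Surplus

variable {V : Type u} (G : SimpleGraph V)

open scoped Classical in
/-- The vertices of `A` that have a neighbour in `Y`. -/
noncomputable def nbrsIn (A Y : Finset V) : Finset V :=
  A.filter (fun a => ∃ y ∈ Y, G.Adj y a)

/-- The number of neighbours of `Y` in `A`, minus the size of `Y`. -/
noncomputable def surplus (A Y : Finset V) : ℤ :=
  ((G.nbrsIn A Y).card : ℤ) - Y.card

variable {G}

theorem mem_nbrsIn {A Y : Finset V} {a : V} :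
    a ∈ G.nbrsIn A Y ↔ a ∈ A ∧ ∃ y ∈ Y, G.Adj y a := by
  classical
  simp [nbrsIn]

theorem nbrsIn_subset (A Y : Finset V) : G.nbrsIn A Y ⊆ A :=
  fun _ ha => (mem_nbrsIn.mp ha).1

theorem nbrsIn_mono (A : Finset V) {Y Z : Finset V} (h : Y ⊆ Z) :
    G.nbrsIn A Y ⊆ G.nbrsIn A Z := by
  intro a ha
  obtain ⟨h1, y, hy, h2⟩ := mem_nbrsIn.mp ha
  exact mem_nbrsIn.mpr ⟨h1, y, h hy, h2⟩

theorem not_adj_of_isIndepSet {I : Finset V} (hI : G.IsIndepSet (I : Set V)) {x y : V}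
    (hx : x ∈ I) (hy : y ∈ I) : ¬ G.Adj x y :=
  fun h => hI hx hy h.ne h

theorem isIndepSet_of_forall_not_adj {I : Finset V} (h : ∀ x ∈ I, ∀ y ∈ I, ¬ G.Adj x y) :
    G.IsIndepSet (I : Set V) :=
  fun x hx y hy _ => h x hx y hy

theorem isIndepSet_subset {I J : Finset V} (hJ : G.IsIndepSet (J : Set V)) (h : I ⊆ J) :
    G.IsIndepSet (I : Set V) :=
  Set.Pairwise.mono (Finset.coe_subset.mpr h) hJ

variable [DecidableEq V]

theorem nbrsIn_union (A Y Z : Finset V) :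
    G.nbrsIn A (Y ∪ Z) = G.nbrsIn A Y ∪ G.nbrsIn A Z := by
  ext a
  simp only [mem_nbrsIn, Finset.mem_union]
  grind

/-- Neighbourhoods commute with unions, while common members only have common neighbours. -/
theorem surplus_submodular (A Y Z : Finset V) :
    G.surplus A (Y ∪ Z) + G.surplus A (Y ∩ Z) ≤ G.surplus A Y + G.surplus A Z := by
  have h1 := Finset.card_union_add_card_inter Y Z
  have h2 := Finset.card_union_add_card_inter (G.nbrsIn A Y) (G.nbrsIn A Z)
  have h3 : (G.nbrsIn A (Y ∩ Z)).card ≤ (G.nbrsIn A Y ∩ G.nbrsIn A Z).card :=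
    Finset.card_le_card (Finset.subset_inter (nbrsIn_mono A Finset.inter_subset_left)
      (nbrsIn_mono A Finset.inter_subset_right))
  unfold surplus
  rw [nbrsIn_union]
  omega

/-- Adding a vertex `b` with a private neighbour does not decrease the surplus. -/
theorem surplus_add_card_le {A Y P : Finset V} {b : V} (hb : b ∉ Y) (hPA : P ⊆ A)
    (hadj : ∀ a ∈ P, G.Adj b a) (hP : Disjoint P (G.nbrsIn A Y)) :
    G.surplus A Y + P.card ≤ G.surplus A (insert b Y) + 1 := by
  have h1 : P ∪ G.nbrsIn A Y ⊆ G.nbrsIn A (insert b Y) := by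
    refine Finset.union_subset (fun a ha => mem_nbrsIn.mpr ⟨hPA ha, b, by simp, hadj a ha⟩)
      (nbrsIn_mono A (Finset.subset_insert _ _))
  have h2 := Finset.card_le_card h1
  rw [Finset.card_union_of_disjoint hP] at h2
  unfold surplus
  rw [Finset.card_insert_of_notMem hb]
  push_cast
  omega

/-- Exchanging the neighbours of an independent set `Y` for `Y` itself. -/
theorem isIndepSet_sdiff_nbrsIn_union {A Y : Finset V} (hA : G.IsIndepSet (A : Set V))
    (hY : G.IsIndepSet (Y : Set V)) : G.IsIndepSet ((A \ G.nbrsIn A Y ∪ Y : Finset V) : Set V) := by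
  apply isIndepSet_of_forall_not_adj
  have key : ∀ x ∈ A \ G.nbrsIn A Y, ∀ y ∈ Y, ¬ G.Adj y x := by
    intro x hx y hy h
    rw [Finset.mem_sdiff] at hx
    exact hx.2 (mem_nbrsIn.mpr ⟨hx.1, y, hy, h⟩)
  intro x hx y hy h
  rcases Finset.mem_union.mp hx with hx | hx <;> rcases Finset.mem_union.mp hy with hy | hy
  · exact not_adj_of_isIndepSet hA (Finset.sdiff_subset hx) (Finset.sdiff_subset hy) h
  · exact key x hx y hy h.symm
  · exact key y hy x hx h
  · exact not_adj_of_isIndepSet hY hx hy h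

theorem card_sdiff_nbrsIn_union {A Y : Finset V} (hYA : Disjoint Y A) :
    ((A \ G.nbrsIn A Y ∪ Y).card : ℤ) = A.card - G.surplus A Y := by
  have h1 : Disjoint (A \ G.nbrsIn A Y) Y :=
    (hYA.mono_right Finset.sdiff_subset).symm
  rw [Finset.card_union_of_disjoint h1, surplus]
  have h2 := Finset.card_sdiff_add_card_eq_card (nbrsIn_subset (G := G) A Y)
  push_cast
  omega

end Surplus

/-! ### Edge-critical graphs: Hall's condition and degrees -/

/-- A graph with independence number `α` and at most `2 * α + D` vertices in which every edge is
critical and every set of at most three vertices is avoided by a maximum independent set. -/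
structure IsCriticalAvoiding {V : Type u} [Fintype V] [DecidableEq V] (G : SimpleGraph V)
    (α D : ℕ) : Prop where
  card_le : ∀ I : Finset V, G.IsIndepSet (I : Set V) → I.card ≤ α
  avoid : ∀ S : Finset V, S.card ≤ 3 →
    ∃ I : Finset V, G.IsIndepSet (I : Set V) ∧ I.card = α ∧ Disjoint I S
  critical : ∀ u v, G.Adj u v → ∃ I : Finset V, u ∈ I ∧ v ∈ I ∧ I.card = α + 1 ∧
    G.IsIndepSet (I.erase u : Set V) ∧ G.IsIndepSet (I.erase v : Set V)
  card_verts : Fintype.card V ≤ 2 * α + D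

namespace IsCriticalAvoiding

variable {V : Type u} [Fintype V] [DecidableEq V] {G : SimpleGraph V} {α D : ℕ}

/-- Otherwise exchanging `Y` for its neighbours would enlarge `A`. -/
theorem surplus_nonneg (h : G.IsCriticalAvoiding α D) {A Y : Finset V}
    (hA : G.IsIndepSet (A : Set V)) (hAα : A.card = α) (hYA : Y ⊆ Aᶜ)
    (hY : G.IsIndepSet (Y : Set V)) : 0 ≤ G.surplus A Y := by
  have hd : Disjoint Y A := Finset.subset_compl_iff_disjoint_right.mp hYA
  have h1 := h.card_le _ (isIndepSet_sdiff_nbrsIn_union hA hY)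
  have h2 := card_sdiff_nbrsIn_union (G := G) hd
  omega

/-- Hall's condition for independent sets. -/
theorem card_le_card_nbrs (h : G.IsCriticalAvoiding α D) (X : Finset V)
    (hX : G.IsIndepSet (X : Set V)) : X.card ≤ (G.nbrsIn Finset.univ X).card := by
  induction X using Finset.strongInduction with
  | H X ih =>
    rcases X.eq_empty_or_nonempty with rfl | ⟨v, hv⟩
    · simp
    -- `X \ J` has enough neighbours inside `J` because `J` is maximum; `X ∩ J` has enough by
    -- induction, all outside `J`. The two sets of neighbours are disjoint.
    obtain ⟨J, hJ, hJα, hvJ⟩ := h.avoid {v} (by simp)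
    have hvJ : v ∉ J := by simpa using hvJ
    have hss : X ∩ J ⊂ X := by
      refine Finset.ssubset_iff_subset_ne.mpr ⟨Finset.inter_subset_left, fun he => ?_⟩
      rw [← he] at hv
      exact hvJ (Finset.mem_inter.mp hv).2
    have h1 := ih _ hss (isIndepSet_subset hX Finset.inter_subset_left)
    have h2 := h.card_le _ (isIndepSet_sdiff_nbrsIn_union hJ
      (isIndepSet_subset hX (Finset.sdiff_subset (s := X) (t := J))))
    have h3 := card_sdiff_nbrsIn_union (G := G) (Finset.sdiff_disjoint (s := J) (t := X))
    unfold surplus at h3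
    have h4 : G.nbrsIn J (X \ J) ∪ G.nbrsIn Finset.univ (X ∩ J) ⊆ G.nbrsIn Finset.univ X := by
      refine Finset.union_subset (fun a ha => ?_) (nbrsIn_mono _ Finset.inter_subset_left)
      obtain ⟨_, y, hy, hya⟩ := mem_nbrsIn.mp ha
      exact mem_nbrsIn.mpr ⟨Finset.mem_univ _, y, Finset.sdiff_subset hy, hya⟩
    have h5 : Disjoint (G.nbrsIn J (X \ J)) (G.nbrsIn Finset.univ (X ∩ J)) := by
      rw [Finset.disjoint_left]
      intro a ha ha'
      obtain ⟨_, y, hy, hya⟩ := mem_nbrsIn.mp ha'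
      exact not_adj_of_isIndepSet hJ (Finset.mem_inter.mp hy).2 (mem_nbrsIn.mp ha).1 hya
    have h6 := Finset.card_le_card h4
    rw [Finset.card_union_of_disjoint h5] at h6
    have h7 := Finset.card_sdiff_add_card_inter X J
    omega

/-- The part of `A` not adjacent to `Y` has all its neighbours in `Aᶜ \ Y`; Hall's condition
compares the sizes. -/
theorem neg_le_surplus (h : G.IsCriticalAvoiding α D) {A Y : Finset V}
    (hA : G.IsIndepSet (A : Set V)) (hAα : A.card = α) (hYA : Y ⊆ Aᶜ) :
    -(D : ℤ) ≤ G.surplus A Y := by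
  have h1 := h.card_le_card_nbrs (A \ G.nbrsIn A Y) (isIndepSet_subset hA Finset.sdiff_subset)
  have h2 : G.nbrsIn Finset.univ (A \ G.nbrsIn A Y) ⊆ Aᶜ \ Y := by
    intro b hb
    obtain ⟨_, a, ha, hab⟩ := mem_nbrsIn.mp hb
    rw [Finset.mem_sdiff] at ha
    rw [Finset.mem_sdiff, Finset.mem_compl]
    exact ⟨fun hbA => not_adj_of_isIndepSet hA ha.1 hbA hab,
      fun hbY => ha.2 (mem_nbrsIn.mpr ⟨ha.1, b, hbY, hab.symm⟩)⟩
  have h3 := Finset.card_le_card h2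
  have h4 := Finset.card_sdiff_add_card_eq_card hYA
  have h5 := Finset.card_sdiff_add_card_eq_card (nbrsIn_subset (G := G) A Y)
  have h6 := h.card_verts
  have h7 := Finset.card_add_card_compl A
  unfold surplus
  omega

/-- A maximum independent set avoiding `v` and all its neighbours could be extended by `v`. Only
here are triples avoided. -/
theorem three_le_card_nbrs (h : G.IsCriticalAvoiding α D) (v : V) :
    3 ≤ (G.nbrsIn Finset.univ {v}).card := by
  by_contra! hlt
  obtain ⟨I, hI, hIα, hd⟩ := h.avoid (insert v (G.nbrsIn Finset.univ {v}))
    ((Finset.card_insert_le _ _).trans (by omega))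
  rw [Finset.disjoint_right] at hd
  have hvI : v ∉ I := hd (Finset.mem_insert_self _ _)
  have hn : ∀ x ∈ I, ¬ G.Adj v x := fun x hx hvx =>
    hd (Finset.mem_insert_of_mem (mem_nbrsIn.mpr ⟨Finset.mem_univ x, v, by simp, hvx⟩)) hx
  have := h.card_le (insert v I) (by
    apply isIndepSet_of_forall_not_adj
    intro x hx y hy hxy
    rcases Finset.mem_insert.mp hx with hxv | hxI <;>
      rcases Finset.mem_insert.mp hy with hyv | hyI
    · exact hxy.ne (hxv.trans hyv.symm)
    · exact hn y hyI (hxv ▸ hxy)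
    · exact hn x hxI (hyv ▸ hxy.symm)
    · exact not_adj_of_isIndepSet hI hxI hyI hxy)
  rw [Finset.card_insert_of_notMem hvI] at this
  omega

end IsCriticalAvoiding

end SimpleGraph

/-! ### Non-isolated vertices outside a maximum independent set -/

namespace SimpleGraph

namespace IsCriticalAvoiding

variable {V : Type u} [Fintype V] [DecidableEq V] {G : SimpleGraph V} {α D : ℕ}

/-- If a sequence of edges `x k, y k` outside a maximum independent set `A`, with critical sets `I k`,
satisfies `x k ∉ I l` for `k < l`, then it is short. -/
theorem not_forall_notMem_critical (h : G.IsCriticalAvoiding α D) {A : Finset V}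
    (hA : G.IsIndepSet (A : Set V)) (hAα : A.card = α) {x : Fin (D + 1) → V}
    {I : Fin (D + 1) → Finset V} (hxA : ∀ k, x k ∉ A) (hIα : ∀ k, (I k).card = α + 1)
    (hI : ∀ k, G.IsIndepSet ((I k).erase (x k) : Set V))
    (hI' : ∀ k, ∃ y, y ≠ x k ∧ y ∉ A ∧ G.IsIndepSet ((I k).erase y : Set V))
    (hlt : ∀ k l, k < l → x k ∉ I l) : False := by
  -- An edge inside `I k` must contain both `x k` and `y`, which lie outside `A`. So `I k \ A` has
  -- no neighbour in `I k ∩ A`, and `I k` has `α + 1` elements.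
  have hY : ∀ k, G.surplus A (I k \ A) ≤ -1 := by
    intro k
    obtain ⟨y, hyx, hyA, hyi⟩ := hI' k
    have hsub : G.nbrsIn A (I k \ A) ⊆ A \ (I k ∩ A) := by
      intro a ha
      obtain ⟨haA, z, hz, hza⟩ := mem_nbrsIn.mp ha
      rw [Finset.mem_sdiff] at hz
      refine Finset.mem_sdiff.mpr ⟨haA, fun haI => ?_⟩
      have haI := (Finset.mem_inter.mp haI).1
      have hax : a ≠ x k := fun e => hxA k (e ▸ haA)
      have hay : a ≠ y := fun e => hyA (e ▸ haA)
      by_cases hzx : z = x k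
      · exact not_adj_of_isIndepSet hyi (Finset.mem_erase.mpr ⟨hzx ▸ hyx.symm, hz.1⟩)
          (Finset.mem_erase.mpr ⟨hay, haI⟩) hza
      · exact not_adj_of_isIndepSet (hI k) (Finset.mem_erase.mpr ⟨hzx, hz.1⟩)
          (Finset.mem_erase.mpr ⟨hax, haI⟩) hza
    have h1 := Finset.card_le_card hsub
    have h2 := Finset.card_sdiff_add_card_eq_card (Finset.inter_subset_right (s₁ := I k) (s₂ := A))
    have h3 := Finset.card_sdiff_add_card_inter (I k) A
    have h4 := hIα k
    unfold surplus
    omega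
  -- The union of the last `j` sets; each further set lowers the surplus by one.
  have key : ∀ j : ℕ, j ≤ D + 1 → G.surplus A
      ((Finset.univ.filter (fun k : Fin (D + 1) => D + 1 ≤ k + j)).biUnion
        (fun k => I k \ A)) ≤ -(j : ℤ) := by
    intro j
    induction j with
    | zero =>
      intro _
      have : (Finset.univ.filter (fun k : Fin (D + 1) => D + 1 ≤ k + 0)) = ∅ := by
        ext k; have := k.2; simp; omega
      rw [this]
      simp [surplus, nbrsIn]
    | succ j ih =>
      intro hj
      have ih := ih (by omega)
      set T := (Finset.univ.filter (fun k : Fin (D + 1) => D + 1 ≤ k + j)).biUnion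
        (fun k => I k \ A) with hT
      let m : Fin (D + 1) := ⟨D - j, by omega⟩
      have hins : (Finset.univ.filter (fun k : Fin (D + 1) => D + 1 ≤ k + (j + 1)))
          = insert m (Finset.univ.filter (fun k : Fin (D + 1) => D + 1 ≤ k + j)) := by
        ext k
        simp only [Finset.mem_filter, Finset.mem_univ, true_and, Finset.mem_insert, m, Fin.ext_iff]
        omega
      rw [hins, Finset.biUnion_insert, ← hT]
      have hsub := surplus_submodular (G := G) A (I m \ A) T
      -- The later sets omit `x m`, so the intersection is independent.
      have hnn : 0 ≤ G.surplus A (I m \ A ∩ T) := by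
        apply h.surplus_nonneg hA hAα
        · intro z hz
          exact Finset.mem_compl.mpr (Finset.mem_sdiff.mp (Finset.mem_inter.mp hz).1).2
        · refine isIndepSet_subset (hI m) fun z hz => Finset.mem_erase.mpr ⟨?_, ?_⟩
          · rintro rfl
            obtain ⟨k, hk, hzk⟩ := Finset.mem_biUnion.mp (Finset.mem_inter.mp hz).2
            refine hlt m k ?_ (Finset.mem_sdiff.mp hzk).1
            have := (Finset.mem_filter.mp hk).2
            simp only [m, Fin.lt_def]
            omega
          · exact (Finset.mem_sdiff.mp (Finset.mem_inter.mp hz).1).1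
      have := hY m
      push_cast
      omega
  have h1 := key (D + 1) le_rfl
  have h2 := h.neg_le_surplus hA hAα (Y := (Finset.univ.filter
      (fun k : Fin (D + 1) => D + 1 ≤ k + (D + 1))).biUnion (fun k => I k \ A)) (by
    intro z hz
    obtain ⟨k, _, hzk⟩ := Finset.mem_biUnion.mp hz
    exact Finset.mem_compl.mpr (Finset.mem_sdiff.mp hzk).2)
  push_cast at h1
  omega

/-- The number of non-isolated vertices in the complement of a maximum independent set is bounded. -/
theorem exists_card_nbrsIn_compl_lt (D : ℕ) : ∃ K : ℕ, ∀ (V : Type u) [Fintype V] [DecidableEq V]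
    (G : SimpleGraph V) (α : ℕ), G.IsCriticalAvoiding α D → ∀ A : Finset V,
      G.IsIndepSet (A : Set V) → A.card = α → (G.nbrsIn Aᶜ Aᶜ).card < K := by
  obtain ⟨K, hK⟩ := exists_ramsey.{u} (Bool × Bool) (D + 3)
  refine ⟨K, fun V _ _ G α h A hA hAα => ?_⟩
  by_contra! hcard
  have hex : ∀ b, ∃ (y : V) (I : Finset V), b ∈ G.nbrsIn Aᶜ Aᶜ → y ∉ A ∧ G.Adj b y ∧ b ∈ I ∧
      I.card = α + 1 ∧ G.IsIndepSet (I.erase b : Set V) ∧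
      G.IsIndepSet (I.erase y : Set V) := by
    intro b
    by_cases hb : b ∈ G.nbrsIn Aᶜ Aᶜ
    · obtain ⟨_, y, hy, hyb⟩ := mem_nbrsIn.mp hb
      obtain ⟨I, h1, _, h3, h4, h5⟩ := h.critical b y hyb.symm
      exact ⟨y, I, fun _ => ⟨Finset.mem_compl.mp hy, hyb.symm, h1, h3, h4, h5⟩⟩
    · exact ⟨b, ∅, fun hb' => absurd hb' hb⟩
  choose y I hyI using hex
  obtain ⟨⟨p, q⟩, s, hs, hsS, hf⟩ :=
    hK _ (fun b b' => (decide (b ∈ I b'), decide (y b ∈ I b'))) hcard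
  have hP := fun k => hyI (s k) (hsS k)
  have hsA : ∀ k, s k ∉ A := fun k => Finset.mem_compl.mp (nbrsIn_subset _ _ (hsS k))
  have hf1 : ∀ i j, i < j → (s i ∈ I (s j) ↔ p = true) := fun i j hij => by
    have := congrArg Prod.fst (hf i j hij); simp only at this; simp [← this]
  have hf2 : ∀ i j, i < j → (y (s i) ∈ I (s j) ↔ q = true) := fun i j hij => by
    have := congrArg Prod.snd (hf i j hij); simp only at this; simp [← this]
  let e : Fin (D + 1) → Fin (D + 3) := Fin.castLE (by omega)
  have he : ∀ k l, k < l → e k < e l := fun k l hkl => hkl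
  by_cases hp : p = true
  · by_cases hq : q = true
    -- The edge from `s i` to `y (s i)` lies in `I (s j)`, so it must pass through `s j`. Two
    -- different values of `j` are then contradictory.
    · have hy : ∀ i j, i < j → y (s i) = s j := by
        intro i j hij
        by_contra hne
        exact not_adj_of_isIndepSet (hP j).2.2.2.2.1
          (Finset.mem_erase.mpr ⟨fun e => hij.ne (hs e), (hf1 i j hij).mpr hp⟩)
          (Finset.mem_erase.mpr ⟨hne, (hf2 i j hij).mpr hq⟩) (hP i).2.1
      have h1 := hy ⟨0, by omega⟩ ⟨1, by omega⟩ (by simp)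
      have h2 := hy ⟨0, by omega⟩ ⟨2, by omega⟩ (by simp [Fin.lt_def])
      have := hs (h1.symm.trans h2)
      simp at this
    · exact h.not_forall_notMem_critical hA hAα (x := fun k => y (s (e k)))
        (I := fun k => I (s (e k))) (fun k => (hP _).1)
        (fun k => (hP _).2.2.2.1) (fun k => (hP _).2.2.2.2.2)
        (fun k => ⟨s (e k), (hP _).2.1.ne, hsA _, (hP _).2.2.2.2.1⟩)
        (fun k l hkl => fun hm => hq ((hf2 _ _ (he k l hkl)).mp hm))
  · exact h.not_forall_notMem_critical hA hAα (x := fun k => s (e k))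
        (I := fun k => I (s (e k))) (fun k => hsA _)
        (fun k => (hP _).2.2.2.1) (fun k => (hP _).2.2.2.2.1)
        (fun k => ⟨y (s (e k)), (hP _).2.1.ne.symm, (hP _).1, (hP _).2.2.2.2.2⟩)
        (fun k l hkl => fun hm => hp ((hf1 _ _ (he k l hkl)).mp hm))

/-! ### Steps and chains of steps -/

/-- `Y` is a tight independent set outside `A` containing `b`, it stays tight when `b` is removed, and
`a` is a neighbour of `b` in `A` that is lost in the removal. -/
structure IsStep {V : Type u} [Fintype V] [DecidableEq V] (G : SimpleGraph V) (A Y : Finset V)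
    (b a : V) : Prop where
  mem : b ∈ Y
  subset : Y ⊆ Aᶜ
  indep : G.IsIndepSet (Y : Set V)
  tight : G.surplus A Y = 0
  tight_erase : G.surplus A (Y.erase b) = 0
  mem_base : a ∈ A
  adj : G.Adj b a
  notMem : a ∉ G.nbrsIn A (Y.erase b)

/-- Two monotone chains of steps at the same vertices but with different lost neighbours are short. -/
theorem not_chain (h : G.IsCriticalAvoiding α D) {A : Finset V}
    (hA : G.IsIndepSet (A : Set V)) (hAα : A.card = α) {b a c : Fin (D + 3) → V}
    {Y W : Fin (D + 3) → Finset V} (hY : ∀ i, IsStep G A (Y i) (b i) (a i))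
    (hW : ∀ i, IsStep G A (W i) (b i) (c i)) (hac : ∀ i, a i ≠ c i)
    (hYlt : ∀ i j, i < j → Y i ⊆ (Y j).erase (b j))
    (hWlt : ∀ i j, i < j → W i ⊆ (W j).erase (b j)) : False := by
  set q : Fin (D + 3) := Fin.last _ with hq
  let U : Fin (D + 3) → Finset V := fun i => Y i ∩ W i
  have hYle : ∀ i j, i ≤ j → Y i ⊆ Y j := by
    intro i j hij
    rcases hij.eq_or_lt with rfl | hij
    · rfl
    · exact (hYlt i j hij).trans (Finset.erase_subset _ _)
  have hWle : ∀ i j, i ≤ j → W i ⊆ W j := by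
    intro i j hij
    rcases hij.eq_or_lt with rfl | hij
    · rfl
    · exact (hWlt i j hij).trans (Finset.erase_subset _ _)
  have hUle : ∀ i j, i ≤ j → U i ⊆ U j := fun i j hij =>
    Finset.inter_subset_inter (hYle i j hij) (hWle i j hij)
  have hmin : ∀ p, ∃ X ∈ Finset.Icc (U p) (U q), ∀ Z ∈ Finset.Icc (U p) (U q),
      G.surplus A X ≤ G.surplus A Z := fun p =>
    Finset.exists_min_image _ _ ⟨U p, Finset.mem_Icc.mpr ⟨le_rfl, hUle _ _ (Fin.le_last p)⟩⟩
  choose X hX hXmin using hmin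
  have hXle : ∀ p, U p ⊆ X p ∧ X p ⊆ U q := fun p => Finset.mem_Icc.mp (hX p)
  have hnn : ∀ Z, Z ⊆ Y q → 0 ≤ G.surplus A Z := fun Z hZ =>
    h.surplus_nonneg hA hAα (hZ.trans (hY q).subset) (isIndepSet_subset (hY q).indep hZ)
  have hnnW : ∀ Z, Z ⊆ W q → 0 ≤ G.surplus A Z := fun Z hZ =>
    h.surplus_nonneg hA hAα (hZ.trans (hW q).subset) (isIndepSet_subset (hW q).indep hZ)
  -- `Y q` and `W q` are tight and their union has surplus at least `-D`.
  have hub : G.surplus A (X q) ≤ D := by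
    have h1 := hXmin q (U q) (Finset.mem_Icc.mpr ⟨le_rfl, le_rfl⟩)
    have h2 := surplus_submodular (G := G) A (Y q) (W q)
    have h3 := h.neg_le_surplus hA hAα (Finset.union_subset (hY q).subset (hW q).subset)
    have h4 := (hY q).tight
    have h5 := (hW q).tight
    simp only [U] at h1
    omega
  have hmono : ∀ p p', p ≤ p' → G.surplus A (X p) ≤ G.surplus A (X p') := fun p p' hpp =>
    hXmin p _ (Finset.mem_Icc.mpr ⟨(hUle _ _ hpp).trans (hXle p').1, (hXle p').2⟩)
  -- The `D + 2` indices below `q` carry nondecreasing minima between `0` and `D`, so two agree.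
  obtain ⟨p, i, hpi, hiq, heq⟩ : ∃ p i : Fin (D + 3), p < i ∧ i < q ∧
      G.surplus A (X i) ≤ G.surplus A (X p) := by
    by_contra! hcon
    have hgrow : ∀ n : ℕ, ∀ hn : n < D + 2, (n : ℤ) ≤ G.surplus A (X ⟨n, by omega⟩) := by
      intro n
      induction n with
      | zero => intro _; exact hnn _ ((hXle _).2.trans Finset.inter_subset_left)
      | succ n ih =>
        intro hn
        have h1 := ih (by omega)
        have h2 := hcon ⟨n, by omega⟩ ⟨n + 1, by omega⟩ (by simp [Fin.lt_def])
          (by simp [Fin.lt_def, hq]; omega)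
        push_cast
        omega
    have h1 := hgrow (D + 1) (by omega)
    have h2 := hmono ⟨D + 1, by omega⟩ q (Fin.le_last _)
    push_cast at h1
    omega
  have hU' : U p ⊆ (Y i).erase (b i) ∩ (W i).erase (b i) :=
    Finset.inter_subset_inter (hYlt p i hpi) (hWlt p i hpi)
  set μ := G.surplus A (X i) with hμ
  have hlow : ∀ Z, U p ⊆ Z → Z ⊆ U q → μ ≤ G.surplus A Z := fun Z h1 h2 =>
    heq.trans (hXmin p Z (Finset.mem_Icc.mpr ⟨h1, h2⟩))
  -- The union with a tight `Z` stays in an independent set, so intersecting with `Z` cannot raise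
  -- the surplus.
  have hcut : ∀ Z, U p ⊆ Z → G.surplus A Z = 0 → (Z ⊆ Y q ∨ Z ⊆ W q) →
      G.surplus A (X i ∩ Z) ≤ μ := by
    intro Z h1 h2 h3
    have h4 := surplus_submodular (G := G) A (X i) Z
    have h5 : 0 ≤ G.surplus A (X i ∪ Z) := by
      rcases h3 with h3 | h3
      · exact hnn _ (Finset.union_subset ((hXle i).2.trans Finset.inter_subset_left) h3)
      · exact hnnW _ (Finset.union_subset ((hXle i).2.trans Finset.inter_subset_right) h3)
    omega
  have hpX : U p ⊆ X i := (hUle _ _ hpi.le).trans (hXle i).1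
  have hcut2 : ∀ Z Z', U p ⊆ Z → U p ⊆ Z' → G.surplus A (X i ∩ Z) ≤ μ →
      G.surplus A (X i ∩ Z') ≤ μ → G.surplus A (X i ∩ Z ∩ (X i ∩ Z')) ≤ μ := by
    intro Z Z' h1 h1' h2 h2'
    have h4 := surplus_submodular (G := G) A (X i ∩ Z) (X i ∩ Z')
    have h5 := hlow (X i ∩ Z ∪ X i ∩ Z')
      ((Finset.subset_inter hpX h1).trans Finset.subset_union_left)
      ((Finset.union_subset Finset.inter_subset_left Finset.inter_subset_left).trans (hXle i).2)
    omega
  have hYq : Y i ⊆ Y q := hYle _ _ hiq.le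
  have hWq : W i ⊆ W q := hWle _ _ hiq.le
  have hUY : U p ⊆ (Y i).erase (b i) := hU'.trans Finset.inter_subset_left
  have hUW : U p ⊆ (W i).erase (b i) := hU'.trans Finset.inter_subset_right
  have hUY' := hUY.trans (Finset.erase_subset _ _)
  have hUW' := hUW.trans (Finset.erase_subset _ _)
  have hbig := hcut2 _ _ hUY' hUW' (hcut _ hUY' (hY i).tight (Or.inl hYq))
    (hcut _ hUW' (hW i).tight (Or.inr hWq))
  set Z := X i ∩ (Y i).erase (b i) ∩ (X i ∩ (W i).erase (b i)) with hZ
  have hZlow : μ ≤ G.surplus A Z :=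
    hlow _ (Finset.subset_inter (Finset.subset_inter hpX hUY) (Finset.subset_inter hpX hUW))
      ((Finset.inter_subset_left.trans Finset.inter_subset_left).trans (hXle i).2)
  have hbX : b i ∈ X i := (hXle i).1 (Finset.mem_inter.mpr ⟨(hY i).mem, (hW i).mem⟩)
  have hins : X i ∩ Y i ∩ (X i ∩ W i) = insert (b i) Z := by
    have h1 := (hY i).mem
    have h2 := (hW i).mem
    ext z
    simp only [hZ, Finset.mem_inter, Finset.mem_insert, Finset.mem_erase]
    by_cases hz : z = b i
    · subst hz; simp [hbX, h1, h2]
    · simp [hz]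
  rw [hins] at hbig
  -- Over `Z`, the vertex `b i` has two private neighbours, so inserting it lifts the surplus above
  -- `μ`, contrary to `hbig`.
  have hgain := surplus_add_card_le (G := G) (A := A) (Y := Z) (b := b i) (P := {a i, c i})
    (by simp [hZ]) (by
      intro z hz
      rcases Finset.mem_insert.mp hz with rfl | hz
      · exact (hY i).mem_base
      · rw [Finset.mem_singleton.mp hz]; exact (hW i).mem_base)
    (by
      intro z hz
      rcases Finset.mem_insert.mp hz with rfl | hz
      · exact (hY i).adj
      · rw [Finset.mem_singleton.mp hz]; exact (hW i).adj)
    (by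
      rw [Finset.disjoint_left]
      intro z hz hzn
      rcases Finset.mem_insert.mp hz with rfl | hz
      · exact (hY i).notMem (nbrsIn_mono A
          (Finset.inter_subset_left.trans Finset.inter_subset_right) hzn)
      · rw [Finset.mem_singleton.mp hz] at hzn
        exact (hW i).notMem (nbrsIn_mono A
          (Finset.inter_subset_right.trans Finset.inter_subset_right) hzn))
  rw [Finset.card_pair (hac i)] at hgain
  push_cast at hgain
  omega

end IsCriticalAvoiding

end SimpleGraph

/-! ### The lattice of tight sets and the final count -/

namespace SimpleGraph

namespace IsCriticalAvoiding

variable {V : Type u} [Fintype V] [DecidableEq V] {G : SimpleGraph V} {α D : ℕ}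

/-- Every edge between a maximum independent set and its complement gives rise to a step. -/
theorem exists_isStep (h : G.IsCriticalAvoiding α D) {A : Finset V}
    (hA : G.IsIndepSet (A : Set V)) (hAα : A.card = α) {a b : V} (ha : a ∈ A)
    (hab : G.Adj b a) : ∃ Y, IsStep G A Y b a := by
  obtain ⟨I, hbI, haI, hIα, hIb, hIa⟩ := h.critical b a hab
  have hbA : b ∉ A := fun hb => not_adj_of_isIndepSet hA hb ha hab
  have hsub : I \ A ⊆ Aᶜ := fun z hz => Finset.mem_compl.mpr (Finset.mem_sdiff.mp hz).2
  have hindep : G.IsIndepSet ((I \ A : Finset V) : Set V) :=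
    isIndepSet_subset hIa fun z hz => by
      rw [Finset.mem_sdiff] at hz
      exact Finset.mem_erase.mpr ⟨fun e => hz.2 (e ▸ ha), hz.1⟩
  have hmem : b ∈ I \ A := Finset.mem_sdiff.mpr ⟨hbI, hbA⟩
  have hY := h.surplus_nonneg hA hAα hsub hindep
  have hY' := h.surplus_nonneg hA hAα ((Finset.erase_subset b _).trans hsub)
    (isIndepSet_subset hindep (Finset.erase_subset b _))
  -- Within `I` every edge contains both `a` and `b`. The inclusions give both surpluses at most
  -- `0`; independence gives the reverse.
  have hn : G.nbrsIn A (I \ A) ⊆ insert a (A \ (I ∩ A)) := by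
    intro z hz
    obtain ⟨hzA, y, hy, hyz⟩ := mem_nbrsIn.mp hz
    by_contra hcon
    rw [Finset.mem_insert, not_or] at hcon
    have hzI : z ∈ I := by
      by_contra hzI
      exact hcon.2 (Finset.mem_sdiff.mpr ⟨hzA, fun h => hzI (Finset.mem_inter.mp h).1⟩)
    rw [Finset.mem_sdiff] at hy
    have hya : y ≠ a := fun e => hy.2 (e ▸ ha)
    exact not_adj_of_isIndepSet hIa (Finset.mem_erase.mpr ⟨hya, hy.1⟩)
      (Finset.mem_erase.mpr ⟨hcon.1, hzI⟩) hyz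
  have hn' : G.nbrsIn A ((I \ A).erase b) ⊆ A \ (I ∩ A) := by
    intro z hz
    obtain ⟨hzA, y, hy, hyz⟩ := mem_nbrsIn.mp hz
    refine Finset.mem_sdiff.mpr ⟨hzA, fun hzI => ?_⟩
    rw [Finset.mem_erase, Finset.mem_sdiff] at hy
    exact not_adj_of_isIndepSet hIb (Finset.mem_erase.mpr ⟨hy.1, hy.2.1⟩)
      (Finset.mem_erase.mpr ⟨fun e => hbA (e ▸ hzA), (Finset.mem_inter.mp hzI).1⟩) hyz
  have h1 := Finset.card_le_card hn
  have h1' := Finset.card_le_card hn'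
  have h2 := Finset.card_insert_le a (A \ (I ∩ A))
  have h3 := Finset.card_sdiff_add_card_eq_card (Finset.inter_subset_right (s₁ := I) (s₂ := A))
  have h4 := Finset.card_sdiff_add_card_inter I A
  have h5 := Finset.card_erase_add_one hmem
  refine ⟨I \ A, hmem, hsub, hindep, ?_, ?_, ha, hab, fun hcon => ?_⟩
  · unfold surplus at *
    omega
  · unfold surplus at *
    omega
  · exact (Finset.mem_sdiff.mp (hn' hcon)).2 (Finset.mem_inter.mpr ⟨haI, ha⟩)

/-- Tight sets minimize a submodular function on the subsets of `C`, hence form a lattice. -/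
theorem surplus_union_inter_eq_zero (h : G.IsCriticalAvoiding α D) {A C Y Z : Finset V}
    (hA : G.IsIndepSet (A : Set V)) (hAα : A.card = α) (hCA : C ⊆ Aᶜ)
    (hC : G.IsIndepSet (C : Set V)) (hYC : Y ⊆ C) (hZC : Z ⊆ C)
    (hY : G.surplus A Y = 0) (hZ : G.surplus A Z = 0) :
    G.surplus A (Y ∪ Z) = 0 ∧ G.surplus A (Y ∩ Z) = 0 := by
  have h1 := surplus_submodular (G := G) A Y Z
  have hu := Finset.union_subset hYC hZC
  have hi := (Finset.inter_subset_left (s₁ := Y) (s₂ := Z)).trans hYC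
  have h2 := h.surplus_nonneg hA hAα (hu.trans hCA) (isIndepSet_subset hC hu)
  have h3 := h.surplus_nonneg hA hAα (hi.trans hCA) (isIndepSet_subset hC hi)
  omega

/-- Among the steps inside an independent set `C`, there is one that is contained in all tight
subsets of `C` through the vertex. -/
theorem exists_least_isStep (h : G.IsCriticalAvoiding α D) {A C Y : Finset V}
    (hA : G.IsIndepSet (A : Set V)) (hAα : A.card = α) (hCA : C ⊆ Aᶜ)
    (hC : G.IsIndepSet (C : Set V)) {b a : V} (hY : IsStep G A Y b a) (hYC : Y ⊆ C) :
    ∃ W ⊆ C, IsStep G A W b a ∧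
      ∀ Z ⊆ C, G.surplus A Z = 0 → b ∈ Z → W ⊆ Z := by
  classical
  obtain ⟨W, hW, hmin⟩ := Finset.exists_min_image
    (C.powerset.filter (fun W => IsStep G A W b a)) Finset.card
    ⟨Y, Finset.mem_filter.mpr ⟨Finset.mem_powerset.mpr hYC, hY⟩⟩
  rw [Finset.mem_filter, Finset.mem_powerset] at hW
  obtain ⟨hWC, hW⟩ := hW
  refine ⟨W, hWC, hW, fun Z hZC hZ hbZ => ?_⟩
  have her : (W ∩ Z).erase b = W.erase b ∩ Z := by
    ext z; simp only [Finset.mem_erase, Finset.mem_inter]; tauto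
  have hst : IsStep G A (W ∩ Z) b a :=
    { mem := Finset.mem_inter.mpr ⟨hW.mem, hbZ⟩
      subset := Finset.inter_subset_left.trans hW.subset
      indep := isIndepSet_subset hW.indep Finset.inter_subset_left
      tight := (h.surplus_union_inter_eq_zero hA hAα hCA hC hWC hZC hW.tight hZ).2
      tight_erase := by
        rw [her]
        exact (h.surplus_union_inter_eq_zero hA hAα hCA hC
          ((Finset.erase_subset _ _).trans hWC) hZC hW.tight_erase hZ).2
      mem_base := hW.mem_base
      adj := hW.adj
      notMem := fun hcon => hW.notMem (nbrsIn_mono A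
        (Finset.erase_subset_erase b Finset.inter_subset_left) hcon) }
  have hle := hmin _ (Finset.mem_filter.mpr
    ⟨Finset.mem_powerset.mpr (Finset.inter_subset_left.trans hWC), hst⟩)
  rw [← Finset.eq_of_subset_of_card_le Finset.inter_subset_left hle]
  exact Finset.inter_subset_right

/-- Pairwise incomparable steps inside an independent set `C` create as many non-isolated vertices in
the complement of some maximum independent set. -/
theorem exists_le_card_nbrsIn_compl (h : G.IsCriticalAvoiding α D) {A C : Finset V}
    (hA : G.IsIndepSet (A : Set V)) (hAα : A.card = α) (hCA : C ⊆ Aᶜ)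
    (hC : G.IsIndepSet (C : Set V)) {K : ℕ} {b a : Fin K → V} {Y : Fin K → Finset V}
    (hb : Function.Injective b) (hbn : ∀ i, b i ∉ G.nbrsIn Aᶜ Aᶜ)
    (hY : ∀ i, IsStep G A (Y i) (b i) (a i)) (hYC : ∀ i, Y i ⊆ C)
    (hanti : ∀ i j, i ≠ j → b i ∉ Y j) :
    ∃ I : Finset V, G.IsIndepSet (I : Set V) ∧ I.card = α ∧ K ≤ (G.nbrsIn Iᶜ Iᶜ).card := by
  set T : Finset V := Finset.univ.biUnion (fun i => (Y i).erase (b i)) with hT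
  have htight : ∀ F : Finset (Fin K), F.biUnion (fun i => (Y i).erase (b i)) ⊆ C ∧
      G.surplus A (F.biUnion (fun i => (Y i).erase (b i))) = 0 := by
    intro F
    induction F using Finset.induction_on with
    | empty => simp [surplus, nbrsIn]
    | insert i F _ ih =>
      rw [Finset.biUnion_insert]
      have hi := (Finset.erase_subset (b i) _).trans (hYC i)
      exact ⟨Finset.union_subset hi ih.1,
        (h.surplus_union_inter_eq_zero hA hAα hCA hC hi ih.1 (hY i).tight_erase ih.2).1⟩
  obtain ⟨hTC, hT0⟩ := htight Finset.univ
  rw [← hT] at hTC hT0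
  have hTA : Disjoint T A := Finset.subset_compl_iff_disjoint_right.mp (hTC.trans hCA)
  refine ⟨A \ G.nbrsIn A T ∪ T, isIndepSet_sdiff_nbrsIn_union hA (isIndepSet_subset hC hTC), ?_, ?_⟩
  · have := card_sdiff_nbrsIn_union (G := G) hTA
    omega
  · have hsub : Finset.univ.image b ⊆
        G.nbrsIn (A \ G.nbrsIn A T ∪ T)ᶜ (A \ G.nbrsIn A T ∪ T)ᶜ := by
      intro z hz
      obtain ⟨i, _, rfl⟩ := Finset.mem_image.mp hz
      have hbA : b i ∉ A := Finset.mem_compl.mp ((hY i).subset (hY i).mem)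
      have hbT : b i ∉ T := by
        intro hcon
        obtain ⟨j, _, hj⟩ := Finset.mem_biUnion.mp hcon
        rw [Finset.mem_erase] at hj
        exact hanti i j (fun e => hj.1 (e ▸ rfl)) hj.2
      obtain ⟨c, hc, hca⟩ := Finset.exists_mem_ne
        (lt_of_lt_of_le (by norm_num) (h.three_le_card_nbrs (b i))) (a i)
      obtain ⟨_, y, hy, hyc⟩ := mem_nbrsIn.mp hc
      rw [Finset.mem_singleton] at hy
      subst hy
      have hcA : c ∈ A := by
        by_contra hcA
        exact hbn i (mem_nbrsIn.mpr ⟨Finset.mem_compl.mpr hbA, c, Finset.mem_compl.mpr hcA,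
          hyc.symm⟩)
      -- Both `Y i` and `(Y i).erase (b i)` are tight, so removing `b i` loses only `a i`, not `c`.
      -- Thus `c` leaves the new independent set and is a neighbour of `b i` outside it.
      have hcT : c ∈ G.nbrsIn A T := by
        refine nbrsIn_mono A (Finset.subset_biUnion_of_mem
          (fun i => (Y i).erase (b i)) (Finset.mem_univ i)) ?_
        by_contra hcon
        have hgain := surplus_add_card_le (G := G) (A := A) (Y := (Y i).erase (b i)) (b := b i)
          (P := {a i, c}) (Finset.notMem_erase _ _)
          (Finset.insert_subset (hY i).mem_base (Finset.singleton_subset_iff.mpr hcA))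
          (by
            intro z hz
            rcases Finset.mem_insert.mp hz with rfl | hz
            · exact (hY i).adj
            · rw [Finset.mem_singleton.mp hz]; exact hyc)
          (by
            rw [Finset.disjoint_left]
            intro z hz
            rcases Finset.mem_insert.mp hz with rfl | hz
            · exact (hY i).notMem
            · rw [Finset.mem_singleton.mp hz]; exact hcon)
        rw [Finset.card_pair hca.symm, Finset.insert_erase (hY i).mem, (hY i).tight,
          (hY i).tight_erase] at hgain
        norm_num at hgain
      have hcTn : c ∉ T := fun hcon => Finset.disjoint_left.mp hTA hcon hcA
      refine mem_nbrsIn.mpr ⟨?_, c, ?_, hyc.symm⟩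
      · simp [hbA, hbT]
      · simp [hcTn, hcT]
    have := Finset.card_le_card hsub
    rwa [Finset.card_image_of_injective _ hb, Finset.card_univ, Fintype.card_fin] at this

/-- Boundedly many vertices have steps for three different neighbours inside three fixed independent
sets. -/
theorem exists_card_lt_of_isStep (D K : ℕ) : ∃ M : ℕ, ∀ (V : Type u) [Fintype V] [DecidableEq V]
    (G : SimpleGraph V) (α : ℕ), G.IsCriticalAvoiding α D →
      (∀ I : Finset V, G.IsIndepSet (I : Set V) → I.card = α → (G.nbrsIn Iᶜ Iᶜ).card < K) →
      ∀ A : Finset V, G.IsIndepSet (A : Set V) → A.card = α →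
      ∀ C : Fin 3 → Finset V, (∀ r, C r ⊆ Aᶜ) → (∀ r, G.IsIndepSet (C r : Set V)) →
      ∀ S : Finset V, (∀ b ∈ S, b ∉ G.nbrsIn Aᶜ Aᶜ) →
        (∀ b ∈ S, ∃ a : Fin 3 → V, Function.Injective a ∧
          ∀ r, ∃ Y ⊆ C r, IsStep G A Y b (a r)) → S.card < M := by
  classical
  -- Length `K` serves antichains and `D + 3` serves chains.
  obtain ⟨M, hM⟩ := exists_ramsey.{u} (Fin 3 → Bool × Bool) (K + (D + 3))
  refine ⟨M, fun V _ _ G α h hK A hA hAα C hCA hC S hSn hS => ?_⟩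
  by_contra! hcard
  have hex : ∀ b, ∃ (a : Fin 3 → V) (Y : Fin 3 → Finset V), b ∈ S → Function.Injective a ∧
      ∀ r, Y r ⊆ C r ∧ IsStep G A (Y r) b (a r) ∧
        ∀ Z ⊆ C r, G.surplus A Z = 0 → b ∈ Z → Y r ⊆ Z := by
    intro b
    by_cases hb : b ∈ S
    · obtain ⟨a, ha, hY⟩ := hS b hb
      have : ∀ r, ∃ W, W ⊆ C r ∧ IsStep G A W b (a r) ∧
          ∀ Z ⊆ C r, G.surplus A Z = 0 → b ∈ Z → W ⊆ Z := fun r => by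
        obtain ⟨Y, hYC, hY⟩ := hY r
        obtain ⟨W, h1, h2⟩ := h.exists_least_isStep hA hAα (hCA r) (hC r) hY hYC
        exact ⟨W, h1, h2⟩
      choose Y hY using this
      exact ⟨a, Y, fun _ => ⟨ha, hY⟩⟩
    · exact ⟨fun _ => b, fun _ => ∅, fun hb' => absurd hb' hb⟩
  choose a Y hY using hex
  obtain ⟨c, s, hs, hsS, hf⟩ := hM S
    (fun b b' r => (decide (b ∈ Y b' r), decide (b' ∈ Y b r))) hcard
  have ha := fun i => (hY (s i) (hsS i)).1
  have hYC := fun i r => ((hY (s i) (hsS i)).2 r).1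
  have hstep := fun i r => ((hY (s i) (hsS i)).2 r).2.1
  have hleast := fun i r => ((hY (s i) (hsS i)).2 r).2.2
  have hc1 : ∀ i j r, i < j → (s i ∈ Y (s j) r ↔ (c r).1 = true) := fun i j r hij => by
    have := congrArg Prod.fst (congrFun (hf i j hij) r); simp only at this; simp [← this]
  have hc2 : ∀ i j r, i < j → (s j ∈ Y (s i) r ↔ (c r).2 = true) := fun i j r hij => by
    have := congrArg Prod.snd (congrFun (hf i j hij) r); simp only at this; simp [← this]
  have hsubset : ∀ i j r, i ≠ j → s i ∈ Y (s j) r → Y (s i) r ⊆ (Y (s j) r).erase (s j) :=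
    fun i j r hij hm => hleast i r _ ((Finset.erase_subset _ _).trans (hYC j r))
      (hstep j r).tight_erase (Finset.mem_erase.mpr ⟨fun e => hij (hs e), hm⟩)
  let e : Fin (D + 3) → Fin (K + (D + 3)) := Fin.castLE (by omega)
  let e' : Fin K → Fin (K + (D + 3)) := Fin.castLE (by omega)
  have hc : ∀ r, (c r).1 = false → (c r).2 = true := by
    intro r hr
    by_contra hr2
    obtain ⟨I, hI, hIα, hIK⟩ := h.exists_le_card_nbrsIn_compl hA hAα (hCA r) (hC r)
      (b := fun i => s (e' i)) (a := fun i => a (s (e' i)) r) (Y := fun i => Y (s (e' i)) r)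
      (hs.comp (Fin.castLE_injective _)) (fun i => hSn _ (hsS _)) (fun i => hstep _ r)
      (fun i => hYC _ r) (fun i j hij hm => by
        rcases lt_or_gt_of_ne hij with hlt | hlt
        · have := (hc1 (e' i) (e' j) r hlt).mp hm
          rw [hr] at this
          exact Bool.false_ne_true this
        · exact hr2 ((hc2 (e' j) (e' i) r hlt).mp hm))
    exact absurd (hK I hI hIα) (not_lt.mpr hIK)
  -- Three families and two directions: two families agree. Descending chains are reversed below.
  obtain ⟨r, r', hrr, heq⟩ := Fintype.exists_ne_map_eq_of_card_lt (fun r => (c r).1)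
    (by simp)
  by_cases hr : (c r).1 = true
  · exact h.not_chain hA hAα (b := fun i => s (e i)) (a := fun i => a (s (e i)) r)
      (c := fun i => a (s (e i)) r') (Y := fun i => Y (s (e i)) r)
      (W := fun i => Y (s (e i)) r') (fun i => hstep _ r) (fun i => hstep _ r')
      (fun i hh => hrr (ha _ hh))
      (fun i j hij => hsubset _ _ r (ne_of_lt (show e i < e j from hij))
        ((hc1 (e i) (e j) r hij).mpr hr))
      (fun i j hij => hsubset _ _ r' (ne_of_lt (show e i < e j from hij))
        ((hc1 (e i) (e j) r' hij).mpr (heq ▸ hr)))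
  · rw [Bool.not_eq_true] at hr
    have hrev : ∀ i j : Fin (D + 3), i < j → e j.rev < e i.rev := fun i j hij =>
      show j.rev < i.rev from Fin.rev_lt_rev.mpr hij
    exact h.not_chain hA hAα (b := fun i => s (e i.rev)) (a := fun i => a (s (e i.rev)) r)
      (c := fun i => a (s (e i.rev)) r') (Y := fun i => Y (s (e i.rev)) r)
      (W := fun i => Y (s (e i.rev)) r') (fun i => hstep _ r) (fun i => hstep _ r')
      (fun i hh => hrr (ha _ hh))
      (fun i j hij => hsubset _ _ r (ne_of_gt (hrev i j hij))
        ((hc2 _ _ r (hrev i j hij)).mpr (hc r hr)))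
      (fun i j hij => hsubset _ _ r' (ne_of_gt (hrev i j hij))
        ((hc2 _ _ r' (hrev i j hij)).mpr (hc r' (heq ▸ hr))))

/-- Edge-critical graphs in which every triple of vertices is avoided by a maximum independent set have
boundedly many vertices in terms of `D`. -/
theorem exists_card_le (D : ℕ) : ∃ N : ℕ, ∀ (V : Type u) [Fintype V] [DecidableEq V]
    (G : SimpleGraph V) (α : ℕ), G.IsCriticalAvoiding α D → Fintype.card V ≤ N := by
  classical
  obtain ⟨K, hK⟩ := exists_card_nbrsIn_compl_lt.{u} D
  obtain ⟨M, hM⟩ := exists_card_lt_of_isStep.{u} D K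
  refine ⟨2 * (K + (2 ^ K) ^ 3 * M), fun V _ _ G α h => ?_⟩
  obtain ⟨A, hA, hAα, -⟩ := h.avoid ∅ (by simp)
  have hK := hK V G α h
  have hM := hM V G α h hK A hA hAα
  set B₁ := G.nbrsIn Aᶜ Aᶜ
  have hB₁K : B₁.card < K := hK A hA hAα
  have hhalf : A.card ≤ Aᶜ.card := by
    refine (h.card_le_card_nbrs A hA).trans (Finset.card_le_card fun z hz => ?_)
    obtain ⟨_, y, hy, hyz⟩ := mem_nbrsIn.mp hz
    exact Finset.mem_compl.mpr fun hzA => not_adj_of_isIndepSet hA hy hzA hyz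
  have hsteps : ∀ b, ∃ (a : Fin 3 → V) (Y : Fin 3 → Finset V), b ∈ Aᶜ \ B₁ →
      Function.Injective a ∧ ∀ r, IsStep G A (Y r) b (a r) := by
    intro b
    by_cases hb : b ∈ Aᶜ \ B₁
    · obtain ⟨P, hP, hP3⟩ := Finset.exists_subset_card_eq (h.three_le_card_nbrs b)
      let a : Fin 3 → V := fun r => ((P.equivFinOfCardEq hP3).symm r : V)
      have ha : ∀ r, G.Adj b (a r) := by
        intro r
        obtain ⟨_, y, hy, hyr⟩ := mem_nbrsIn.mp (hP ((P.equivFinOfCardEq hP3).symm r).2)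
        rwa [Finset.mem_singleton.mp hy] at hyr
      rw [Finset.mem_sdiff] at hb
      have haA : ∀ r, a r ∈ A := by
        intro r
        by_contra hcon
        exact hb.2 (mem_nbrsIn.mpr ⟨hb.1, a r, Finset.mem_compl.mpr hcon, (ha r).symm⟩)
      choose Y hY using fun r => h.exists_isStep hA hAα (haA r) (ha r)
      exact ⟨a, Y, fun _ => ⟨Subtype.val_injective.comp (Equiv.injective _), hY⟩⟩
    · exact ⟨fun _ => b, fun _ => ∅, fun hb' => absurd hb' hb⟩
  choose a Y hY using hsteps
  -- Vertices are classed by the traces of their three tight sets on `B₁`.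
  have hB₀ : (Aᶜ \ B₁).card ≤ (2 ^ K) ^ 3 * M := by
    by_contra! hlt
    obtain ⟨t, -, ht⟩ := Finset.exists_lt_card_fiber_of_mul_lt_card_of_maps_to
      (s := Aᶜ \ B₁) (t := Fintype.piFinset (fun _ : Fin 3 => B₁.powerset))
      (f := fun b r => Y b r ∩ B₁) (n := M)
      (fun b _ => Fintype.mem_piFinset.mpr fun r => Finset.mem_powerset.mpr
        Finset.inter_subset_right)
      (by
        refine lt_of_le_of_lt (Nat.mul_le_mul_right _ ?_) hlt
        simp only [Fintype.card_piFinset, Finset.card_powerset, Finset.prod_const,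
          Finset.card_univ, Fintype.card_fin]
        gcongr
        norm_num)
    set S := (Aᶜ \ B₁).filter (fun b => (fun r => Y b r ∩ B₁) = t) with hS
    have hSm : ∀ b ∈ S, b ∈ Aᶜ \ B₁ ∧ ∀ r, Y b r ∩ B₁ = t r := fun b hb =>
      ⟨(Finset.mem_filter.mp hb).1, congrFun (Finset.mem_filter.mp hb).2⟩
    obtain ⟨b₀, hb₀⟩ : S.Nonempty := Finset.card_pos.mp (by omega)
    have htY : ∀ r, t r ⊆ Y b₀ r := fun r => (hSm b₀ hb₀).2 r ▸ Finset.inter_subset_left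
    have hY₀ := (hY b₀ (hSm b₀ hb₀).1).2
    have hCA : ∀ r, Aᶜ \ B₁ ∪ t r ⊆ Aᶜ := fun r =>
      Finset.union_subset Finset.sdiff_subset ((htY r).trans (hY₀ r).subset)
    refine absurd (hM (fun r => Aᶜ \ B₁ ∪ t r) hCA (fun r => ?_) S
      (fun b hb => (Finset.mem_sdiff.mp (hSm b hb).1).2) (fun b hb => ?_)) (not_lt.mpr ht.le)
    -- Vertices off `B₁` are isolated in `Aᶜ`, so an edge would lie in `t r`, which is part of the
    -- independent set `Y b₀ r`.
    · apply isIndepSet_of_forall_not_adj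
      have key : ∀ x ∈ Aᶜ \ B₁ ∪ t r, ∀ y ∈ Aᶜ \ B₁ ∪ t r, G.Adj x y → x ∈ t r := by
        intro x hx y hy hxy
        rcases Finset.mem_union.mp hx with hx' | hx'
        · exact absurd (mem_nbrsIn.mpr ⟨hCA r hx, y, hCA r hy, hxy.symm⟩)
            (Finset.mem_sdiff.mp hx').2
        · exact hx'
      intro x hx y hy hxy
      exact not_adj_of_isIndepSet (hY₀ r).indep (htY r (key x hx y hy hxy))
        (htY r (key y hy x hx hxy.symm)) hxy
    · obtain ⟨hb, hbt⟩ := hSm b hb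
      refine ⟨a b, (hY b hb).1, fun r => ⟨Y b r, fun z hz => ?_, (hY b hb).2 r⟩⟩
      by_cases hzB : z ∈ B₁
      · exact Finset.mem_union_right _ (hbt r ▸ Finset.mem_inter.mpr ⟨hz, hzB⟩)
      · exact Finset.mem_union_left _
          (Finset.mem_sdiff.mpr ⟨((hY b hb).2 r).subset hz, hzB⟩)
  have h1 : (Aᶜ \ B₁).card + B₁.card = Aᶜ.card :=
    Finset.card_sdiff_add_card_eq_card (nbrsIn_subset Aᶜ Aᶜ)
  have h2 := Finset.card_add_card_compl A
  omega

end IsCriticalAvoiding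

/-! ### From stable graphs to edge-critical ones -/

/-- A graph in which every triple is avoided by a maximum independent set has a spanning subgraph with
the same independence number and this property in which, moreover, every edge is critical. -/
theorem exists_isCriticalAvoiding {V : Type u} [Fintype V] [DecidableEq V] (G : SimpleGraph V)
    {D : ℕ} (hD : Fintype.card V ≤ 2 * G.indepNum + D)
    (hG : ∀ S : Finset V, S.card ≤ 3 →
      ∃ I : Finset V, G.IsIndepSet (I : Set V) ∧ I.card = G.indepNum ∧ Disjoint I S) :
    ∃ H : SimpleGraph V, H.IsCriticalAvoiding G.indepNum D := by
  classical
  -- Edge-minimality makes each edge critical: deleting it must create a larger independent set.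
  obtain ⟨H, hHG, hH⟩ := (Set.toFinite {H : SimpleGraph V | ∀ I : Finset V,
    H.IsIndepSet (I : Set V) → I.card ≤ G.indepNum}).exists_le_minimal
    (a := G) (fun I hI => hI.card_le_indepNum)
  refine ⟨H, hH.prop, fun S hS => ?_, fun u v huv => ?_, hD⟩
  · obtain ⟨I, hI, h1, h2⟩ := hG S hS
    exact ⟨I, isIndepSet_of_forall_not_adj fun x hx y hy hxy =>
      not_adj_of_isIndepSet hI hx hy (hHG hxy), h1, h2⟩
  · have hdel : ∀ x y, (H.deleteEdges {s(u, v)}).Adj x y ↔ H.Adj x y ∧ s(x, y) ≠ s(u, v) := by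
      intro x y
      simp [deleteEdges_adj]
    obtain ⟨I, hI, hIlt⟩ : ∃ I : Finset V, (H.deleteEdges {s(u, v)}).IsIndepSet (I : Set V) ∧
        G.indepNum < I.card := by
      by_contra! hcon
      have := hH.le_of_le hcon (deleteEdges_le _) huv
      exact ((hdel u v).mp this).2 rfl
    have hadj : ∀ x ∈ I, ∀ y ∈ I, H.Adj x y → s(x, y) = s(u, v) := by
      intro x hx y hy hxy
      by_contra hne
      exact not_adj_of_isIndepSet hI hx hy ((hdel x y).mpr ⟨hxy, hne⟩)
    have herase : ∀ w, w = u ∨ w = v → H.IsIndepSet (I.erase w : Set V) := by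
      intro w hw
      apply isIndepSet_of_forall_not_adj
      intro x hx y hy hxy
      rw [Finset.mem_erase] at hx hy
      have := hadj x hx.2 y hy.2 hxy
      rw [Sym2.eq_iff] at this
      rcases hw with rfl | rfl <;> rcases this with ⟨rfl, rfl⟩ | ⟨rfl, rfl⟩ <;> simp_all
    have hmem : ∀ w, w = u ∨ w = v → w ∈ I := by
      intro w hw
      by_contra hwI
      have := hH.prop I (by
        have := herase w hw
        rwa [Finset.erase_eq_of_notMem hwI] at this)
      omega
    have hu := hmem u (Or.inl rfl)
    have h1 := hH.prop (I.erase u) (herase u (Or.inl rfl))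
    rw [Finset.card_erase_of_mem hu] at h1
    exact ⟨I, hu, hmem v (Or.inr rfl), by omega, herase u (Or.inl rfl),
      herase v (Or.inr rfl)⟩

/-- In a stable graph with enough vertices, small sets are avoided by maximum independent sets. -/
theorem IsStable.exists_isIndepSet_disjoint {V : Type*} [Fintype V] {G : SimpleGraph V} {k : ℕ}
    (hG : G.IsStable k 0) (hk : k ≤ Fintype.card V) (S : Finset V) (hS : S.card ≤ k) :
    ∃ I : Finset V, G.IsIndepSet (I : Set V) ∧ I.card = G.indepNum ∧ Disjoint I S := by
  classical
  obtain ⟨T, hST, hT⟩ := Finset.exists_superset_card_eq hS hk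
  obtain ⟨J, hJ⟩ := (G.induce ((T : Set V)ᶜ)).exists_isNIndepSet_indepNum
  have hle := hG T hT
  let I : Finset V := J.map ⟨Subtype.val, Subtype.val_injective⟩
  have hI : G.IsIndepSet (I : Set V) := by
    apply isIndepSet_of_forall_not_adj
    intro x hx y hy hxy
    obtain ⟨x', hx', rfl⟩ := Finset.mem_map.mp hx
    obtain ⟨y', hy', rfl⟩ := Finset.mem_map.mp hy
    exact not_adj_of_isIndepSet hJ.isIndepSet hx' hy' hxy
  have hIc : I.card = J.card := Finset.card_map _
  refine ⟨I, hI, le_antisymm hI.card_le_indepNum ?_, ?_⟩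
  · rw [hIc, hJ.card_eq]
    exact hle
  · rw [Finset.disjoint_left]
    intro x hx hxS
    obtain ⟨x', _, rfl⟩ := Finset.mem_map.mp hx
    exact x'.2 (Finset.mem_coe.mpr (hST hxS))

/-- Stable graphs whose independence number is within `q` of half the number of vertices have boundedly
many vertices. -/
theorem IsStable.exists_card_le (q : ℝ) (k : ℕ) (hk : 3 ≤ k) :
    ∃ C : ℕ, ∀ (V : Type u) [Fintype V] (G : SimpleGraph V),
      G.IsStable k 0 → (Fintype.card V : ℝ) / 2 - q ≤ (G.indepNum : ℝ) →
        Fintype.card V ≤ C := by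
  classical
  obtain ⟨N, hN⟩ := IsCriticalAvoiding.exists_card_le.{u} ⌈2 * q⌉₊
  -- With fewer than `k` vertices stability is vacuous, so `k` enters the bound.
  refine ⟨max k N, fun V _ G hG hq => ?_⟩
  rcases le_total (Fintype.card V) k with hle | hle
  · exact hle.trans (le_max_left _ _)
  have hD : Fintype.card V ≤ 2 * G.indepNum + ⌈2 * q⌉₊ := by
    have := Nat.le_ceil (2 * q)
    have h2 : (Fintype.card V : ℝ) ≤ ((2 * G.indepNum + ⌈2 * q⌉₊ : ℕ) : ℝ) := by
      push_cast
      linarith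
    exact_mod_cast h2
  obtain ⟨H, hH⟩ := G.exists_isCriticalAvoiding hD
    (fun S hS => hG.exists_isIndepSet_disjoint hle S (hS.trans hk))
  exact (hN V H _ hH).trans (le_max_right _ _)

end SimpleGraph

theorem theorem1p4 :
    (∀ (q : ℝ) (k : ℕ), 0 < q → 3 ≤ k →
      ∃ C : ℕ, ∀ (V : Type u) [Fintype V] (G : SimpleGraph V),
        G.IsStable k 0 → (Fintype.card V : ℝ) / 2 - q ≤ (G.indepNum : ℝ) →
          Fintype.card V ≤ C) ∧
    ¬ ∃ c : ℝ, 0 < c ∧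
      ∃ (V : ℕ → Type u) (_ : ∀ i, Fintype (V i)) (G : ∀ i, SimpleGraph (V i)),
        (∀ i, (G i).IsStable 3 0) ∧
        Filter.Tendsto (fun i => Fintype.card (V i)) Filter.atTop Filter.atTop ∧
        ∀ i, (Fintype.card (V i) : ℝ) / 2 - c ≤ ((G i).indepNum : ℝ) := by
  refine ⟨fun q k _ hk => SimpleGraph.IsStable.exists_card_le q k hk, ?_⟩
  rintro ⟨c, _, V, _, G, hG, hlim, hα⟩
  obtain ⟨C, hC⟩ := SimpleGraph.IsStable.exists_card_le.{u} c 3 le_rfl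
  obtain ⟨i, hi⟩ := (hlim.eventually_gt_atTop C).exists
  exact absurd (hC (V i) (G i) (hG i) (hα i)) (not_le.mpr hi)
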